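/- For a Heyting algebra $A$ let $W=A\times A$, and let $N$ be the binary relation on $W$ given by $(s,a)\,N\,(t,b)$ iff $s\vee t\vee(a\to b)=1$. For $X\subseteq W$ put $U(X)=\{u\in W : w\,N\,u \text{ for all } w\in X\}$ and $L(X)=\{w\in W : w\,N\,u\text{ for all }u\in X\}$. The hyper-MacNeille completion $A^+$ of $A$ is the complete Heyting algebra of Galois closed sets, that is, of all $X\subseteq W$ with $X=L(U(X))$, ordered by inclusion; its implication is $X\to Y=\{(s,a)\in W : (t\vee s,\,b\wedge a)\in Y\text{ for all }(t,b)\in X\}$. A variety of Heyting algebras is a class of Heyting algebras closed under homomorphic images, subalgebras and products (up to isomorphism). Theorem. Let $E$ be a finite Heyting algebra and let $\mathcal V$ be the variety of Heyting algebras generated by $E$, i.e. the least variety containing $E$. Then $\mathcal V$ is closed under hyper-MacNeille completions: if $A\in\mathcal V$, then $A^+\in\mathcal V$. -/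

import Mathlib

universe u

/-! ### The hyper-MacNeille completion of a Heyting algebra -/

/-- The binary relation `N` on `A × A`: `(s, a) N (t, b)` iff `s ⊔ t ⊔ (a ⇨ b) = ⊤`. -/
def hyperRel (A : Type u) [HeytingAlgebra A] (w v : A × A) : Prop :=
  w.1 ⊔ v.1 ⊔ (w.2 ⇨ v.2) = ⊤

/-- The hyper-MacNeille completion of `A`: the Galois closed subsets `X = L (U X)` of `A × A` for
the polarity `(A × A, A × A, N)`. A `Concept` is a Galois closed set `X` (its `extent`) bundled
with `U X` (its `intent`), so it is determined by its extent. -/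
def HyperMacNeille (A : Type u) [HeytingAlgebra A] : Type u :=
  Concept (A × A) (A × A) (hyperRel A)

namespace HyperMacNeille

variable {A : Type u} [HeytingAlgebra A]

/-- The complete lattice of Galois closed sets, ordered by inclusion of extents: meets are
intersections and joins are the closures of unions. -/
instance instCompleteLattice : CompleteLattice (HyperMacNeille A) :=
  inferInstanceAs (CompleteLattice (Concept (A × A) (A × A) (hyperRel A)))

/-- The Galois closed set underlying an element of the hyper-MacNeille completion. -/
def carrier (X : HyperMacNeille A) : Set (A × A) :=
  Concept.extent X

theorem le_iff {X Y : HyperMacNeille A} : X ≤ Y ↔ X.carrier ⊆ Y.carrier :=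
  Iff.rfl

theorem carrier_inf (X Y : HyperMacNeille A) : (X ⊓ Y).carrier = X.carrier ∩ Y.carrier :=
  rfl

theorem closed (X : HyperMacNeille A) :
    lowerPolar (hyperRel A) (upperPolar (hyperRel A) X.carrier) = X.carrier :=
  (Concept.isExtent_extent (r := hyperRel A) X).eq

theorem ext_carrier {X Y : HyperMacNeille A} (h : X.carrier = Y.carrier) : X = Y :=
  Concept.ext h

/-- The monoid operation `(s, a) ∘ (t, b) = (s ⊔ t, a ⊓ b)` on `A × A`. -/
def comp (w v : A × A) : A × A := (w.1 ⊔ v.1, w.2 ⊓ v.2)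

/-- The operation `(s, a) ⇝ (t, b) = (s ⊔ t, a ⇨ b)` on `A × A`. -/
def residual (w v : A × A) : A × A := (w.1 ⊔ v.1, w.2 ⇨ v.2)

theorem hyperRel_comp_iff (w v z : A × A) :
    hyperRel A (comp w v) z ↔ hyperRel A v (residual w z) := by
  simp only [hyperRel, comp, residual, himp_himp, sup_assoc, sup_left_comm, inf_comm]

theorem hyperRel_comp_right {w v z : A × A} (h : hyperRel A w z) :
    hyperRel A (comp w v) z := by
  refine top_le_iff.1 (h.ge.trans ?_)
  exact sup_le_sup (sup_le_sup_right le_sup_left _) (himp_le_himp_right inf_le_left)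

theorem mem_iff {X : HyperMacNeille A} {w : A × A} :
    w ∈ X.carrier ↔ ∀ z ∈ upperPolar (hyperRel A) X.carrier, hyperRel A w z := by
  conv_lhs => rw [← X.closed]
  rfl

theorem comp_mem {X : HyperMacNeille A} {w : A × A} (hw : w ∈ X.carrier) (v : A × A) :
    comp w v ∈ X.carrier :=
  mem_iff.2 fun z hz => hyperRel_comp_right (mem_iff.1 hw z hz)

theorem comp_comm (w v : A × A) : comp w v = comp v w := by
  simp [comp, sup_comm, inf_comm]

theorem comp_self (w : A × A) : comp w w = w := by
  simp [comp]

/-- The set `{w | ∀ v ∈ X, v ∘ w ∈ Y}` is Galois closed. -/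
theorem isExtent_himp (X Y : HyperMacNeille A) :
    Order.IsExtent (hyperRel A) {w | ∀ v ∈ X.carrier, comp v w ∈ Y.carrier} := by
  refine ⟨{u | ∃ v ∈ X.carrier, ∃ z ∈ upperPolar (hyperRel A) Y.carrier, residual v z = u}, ?_⟩
  ext w
  constructor
  · intro h v hv
    exact mem_iff.2 fun z hz => (hyperRel_comp_iff v w z).2 (h ⟨v, hv, z, hz, rfl⟩)
  · rintro h _ ⟨v, hv, z, hz, rfl⟩
    exact (hyperRel_comp_iff v w z).1 (mem_iff.1 (h v hv) z hz)

/-- The implication of the hyper-MacNeille completion,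
`X ⇨ Y = {w | ∀ v ∈ X, v ∘ w ∈ Y}`. -/
def imp (X Y : HyperMacNeille A) : HyperMacNeille A :=
  Concept.ofIsExtent (hyperRel A) {w | ∀ v ∈ X.carrier, comp v w ∈ Y.carrier}
    (isExtent_himp X Y)

theorem le_imp_iff (Z X Y : HyperMacNeille A) : Z ≤ imp X Y ↔ Z ⊓ X ≤ Y := by
  rw [le_iff, le_iff, carrier_inf]
  constructor
  · rintro h w ⟨hz, hx⟩
    have := h hz w hx
    rwa [comp_self] at this
  · intro h z hz v hv
    exact h ⟨by rw [comp_comm]; exact comp_mem hz v, comp_mem hv z⟩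

/-- The hyper-MacNeille completion as a Heyting algebra, for the inclusion order. -/
instance instHeytingAlgebra : HeytingAlgebra (HyperMacNeille A) :=
  { instCompleteLattice (A := A) with
    himp := imp
    le_himp_iff := fun Z X Y => le_imp_iff Z X Y
    compl := fun X => imp X ⊥
    himp_bot := fun _ => rfl }

end HyperMacNeille

/-! ### Varieties of Heyting algebras -/

/-- A variety of Heyting algebras: a class of Heyting algebras closed under homomorphic images,
subalgebras and products (the latter two up to isomorphism). -/
structure IsHeytingVariety (V : Set HeytAlg.{u}) : Prop where
  homomorphicImage : ∀ A ∈ V, ∀ (B : HeytAlg.{u}) (f : HeytingHom A B),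
    Function.Surjective f → B ∈ V
  subalgebra : ∀ A ∈ V, ∀ (B : HeytAlg.{u}) (f : HeytingHom B A),
    Function.Injective f → B ∈ V
  product : ∀ (ι : Type u) (F : ι → HeytAlg.{u}), (∀ i, F i ∈ V) →
    HeytAlg.of (∀ i, F i) ∈ V

/-- `V` is the variety generated by `E`: the least variety that contains `E`. -/
structure IsVarietyGeneratedBy (V : Set HeytAlg.{u}) (E : HeytAlg.{u}) : Prop where
  isVariety : IsHeytingVariety V
  mem : E ∈ V
  least : ∀ W : Set HeytAlg.{u}, IsHeytingVariety W → E ∈ W → V ⊆ W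

/-- `V` is closed under hyper-MacNeille completions. -/
def ClosedUnderHyperMacNeille (V : Set HeytAlg.{u}) : Prop :=
  ∀ A ∈ V, HeytAlg.of (HyperMacNeille A) ∈ V

/-! Treat the proper elements `t ≠ ⊤` of `A` as forcing conditions, extended by going up, and
compare elements at `t` modulo the filter `{c | t ⊔ c = ⊤}`. The relation `N` can be tested on a
dense set of conditions (`hyperRel_of_dense`). Hence a function `A → A` that is densely constant
modulo these filters determines a Galois closed set. Such functions form a subalgebra of the power
of `A` indexed by `A`, and the passage to closed sets is a homomorphism into `A⁺`.

Finiteness of `E` gives surjectivity. An equation true in `E`, hence in `A`, forbids long chains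
that are strictly decreasing at a proper condition, so every closed set has a value at densely many
conditions (`exists_isValueAt`). Choosing values gives a preimage, and `A⁺` is a homomorphic image
of a subalgebra of a power of `A`. -/

/-! ### Comparing elements locally -/

section LeAt

variable {A : Type u} [HeytingAlgebra A]

/-- `a` lies below `b` modulo the filter of all `c` with `t ⊔ c = ⊤`. -/
def LeAt (t a b : A) : Prop := t ⊔ (a ⇨ b) = ⊤

namespace LeAt

variable {r t a b c d : A}

theorem of_le (h : a ≤ b) : LeAt t a b := by
  simp [LeAt, himp_eq_top_iff.2 h]

theorem refl (t a : A) : LeAt t a a := of_le le_rfl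

theorem mono (h : LeAt t a b) (htr : t ≤ r) : LeAt r a b :=
  top_le_iff.1 (h.ge.trans (sup_le_sup_right htr _))

/-- By distributivity, `{c | t ⊔ c = ⊤}` is closed under meets. Each rule with two premises thus
reduces to an inequality between implications. -/
theorem inf_of_imp (h₁ : LeAt t a b) (h₂ : LeAt t c d) {p q : A}
    (h : (a ⇨ b) ⊓ (c ⇨ d) ≤ p ⇨ q) : LeAt t p q := by
  refine top_le_iff.1 (le_trans ?_ (sup_le_sup_left h t))
  rw [sup_inf_left, show t ⊔ (a ⇨ b) = ⊤ from h₁, show t ⊔ (c ⇨ d) = ⊤ from h₂, inf_top_eq]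

theorem trans (h₁ : LeAt t a b) (h₂ : LeAt t b c) : LeAt t a c :=
  h₁.inf_of_imp h₂ (by rw [inf_comm]; exact _root_.le_himp_iff.1 himp_le_himp_himp_himp)

theorem le_inf (h₁ : LeAt t a b) (h₂ : LeAt t a c) : LeAt t a (b ⊓ c) :=
  h₁.inf_of_imp h₂ (himp_inf_distrib _ _ _).ge

theorem sup_le (h₁ : LeAt t a c) (h₂ : LeAt t b c) : LeAt t (a ⊔ b) c :=
  h₁.inf_of_imp h₂ (sup_himp_distrib _ _ _).ge

theorem le_himp_iff : LeAt t a (b ⇨ c) ↔ LeAt t (a ⊓ b) c := by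
  rw [LeAt, LeAt, himp_himp]

theorem inf (h₁ : LeAt t a b) (h₂ : LeAt t c d) : LeAt t (a ⊓ c) (b ⊓ d) :=
  ((of_le inf_le_left).trans h₁).le_inf ((of_le inf_le_right).trans h₂)

theorem sup (h₁ : LeAt t a b) (h₂ : LeAt t c d) : LeAt t (a ⊔ c) (b ⊔ d) :=
  (h₁.trans (of_le le_sup_left)).sup_le (h₂.trans (of_le le_sup_right))

theorem himp (h₁ : LeAt t b a) (h₂ : LeAt t c d) : LeAt t (a ⇨ c) (b ⇨ d) :=
  le_himp_iff.2 ((((refl t _).inf h₁).trans (of_le himp_inf_le)).trans h₂)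

/-- A condition absorbing `a ⇨ b` refutes the comparison of `a` with `b` at all its proper
extensions. -/
theorem eq_top (h : LeAt t a b) (hle : a ⇨ b ≤ t) : t = ⊤ := by
  rwa [LeAt, sup_eq_left.2 hle] at h

end LeAt

/-- To compare two pairs it suffices to do so after passing to an extension in a dense set. -/
theorem hyperRel_of_dense {w v : A × A}
    (h : ∀ s, s ≠ ⊤ → w.1 ≤ s → v.1 ≤ s → ∃ t, s ≤ t ∧ t ≠ ⊤ ∧ LeAt t w.2 v.2) :
    hyperRel A w v := by
  by_contra hne
  -- This join is a proper condition precisely because `N` fails, and it absorbs the implication.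
  obtain ⟨t, hst, ht, hle⟩ := h (w.1 ⊔ v.1 ⊔ (w.2 ⇨ v.2)) hne
    (le_sup_left.trans le_sup_left) (le_sup_right.trans le_sup_left)
  exact ht (hle.eq_top (le_sup_right.trans hst))

end LeAt

/-! ### Generically constant functions -/

section Generic

variable {A : Type u} [HeytingAlgebra A]

/-- `f` agrees with the constant `b` at all extensions of `t`. -/
def Decides (f : A → A) (t b : A) : Prop :=
  ∀ r, t ≤ r → LeAt r (f r) b ∧ LeAt r b (f r)

namespace Decides

variable {f g : A → A} {r t b c : A}

theorem mono (h : Decides f t b) (htr : t ≤ r) : Decides f r b :=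
  fun q hq => h q (htr.trans hq)

theorem const (t b : A) : Decides (fun _ => b) t b :=
  fun r _ => ⟨.refl r b, .refl r b⟩

theorem inf (hf : Decides f t b) (hg : Decides g t c) : Decides (f ⊓ g) t (b ⊓ c) :=
  fun r hr => ⟨(hf r hr).1.inf (hg r hr).1, (hf r hr).2.inf (hg r hr).2⟩

theorem sup (hf : Decides f t b) (hg : Decides g t c) : Decides (f ⊔ g) t (b ⊔ c) :=
  fun r hr => ⟨(hf r hr).1.sup (hg r hr).1, (hf r hr).2.sup (hg r hr).2⟩

/-- Implication is antitone in its first argument, so both comparisons in `Decides` are needed. -/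
theorem himp (hf : Decides f t b) (hg : Decides g t c) : Decides (f ⇨ g) t (b ⇨ c) :=
  fun r hr => ⟨(hf r hr).2.himp (hg r hr).1, (hf r hr).1.himp (hg r hr).2⟩

theorem leAt (h : Decides f t b) (h' : Decides f r c) : LeAt (t ⊔ r) b c :=
  (h _ le_sup_left).2.trans (h' _ le_sup_right).1

end Decides

/-- `f` is generically constant: every proper `s` extends to a proper `t` that decides `f`. -/
def GenericallyConstant (f : A → A) : Prop :=
  ∀ s, s ≠ ⊤ → ∃ t, s ≤ t ∧ t ≠ ⊤ ∧ ∃ b, Decides f t b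

namespace GenericallyConstant

variable {f g : A → A}

theorem const (b : A) : GenericallyConstant fun _ : A => b :=
  fun s hs => ⟨s, le_rfl, hs, b, .const s b⟩

theorem exists_pair (hf : GenericallyConstant f) (hg : GenericallyConstant g) {s : A}
    (hs : s ≠ ⊤) : ∃ t, s ≤ t ∧ t ≠ ⊤ ∧ ∃ b c, Decides f t b ∧ Decides g t c := by
  obtain ⟨t, hst, ht, b, hb⟩ := hf s hs
  obtain ⟨r, htr, hr, c, hc⟩ := hg t ht
  exact ⟨r, hst.trans htr, hr, b, c, hb.mono htr, hc⟩

theorem inf (hf : GenericallyConstant f) (hg : GenericallyConstant g) :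
    GenericallyConstant (f ⊓ g) := fun _ hs =>
  let ⟨t, hst, ht, _, _, hb, hc⟩ := hf.exists_pair hg hs
  ⟨t, hst, ht, _, hb.inf hc⟩

theorem sup (hf : GenericallyConstant f) (hg : GenericallyConstant g) :
    GenericallyConstant (f ⊔ g) := fun _ hs =>
  let ⟨t, hst, ht, _, _, hb, hc⟩ := hf.exists_pair hg hs
  ⟨t, hst, ht, _, hb.sup hc⟩

theorem himp (hf : GenericallyConstant f) (hg : GenericallyConstant g) :
    GenericallyConstant (f ⇨ g) := fun _ hs =>
  let ⟨t, hst, ht, _, _, hb, hc⟩ := hf.exists_pair hg hs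
  ⟨t, hst, ht, _, hb.himp hc⟩

end GenericallyConstant

variable (A) in
/-- The Heyting algebra of generically constant functions. -/
def GenericFun : Type u := {f : A → A // GenericallyConstant f}

namespace GenericFun

instance : Max (GenericFun A) := ⟨fun f g => ⟨f.1 ⊔ g.1, f.2.sup g.2⟩⟩
instance : Min (GenericFun A) := ⟨fun f g => ⟨f.1 ⊓ g.1, f.2.inf g.2⟩⟩
instance : HImp (GenericFun A) := ⟨fun f g => ⟨f.1 ⇨ g.1, f.2.himp g.2⟩⟩
instance : Top (GenericFun A) := ⟨⟨⊤, .const ⊤⟩⟩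
instance : Bot (GenericFun A) := ⟨⟨⊥, .const ⊥⟩⟩
instance : Compl (GenericFun A) := ⟨fun f => f ⇨ ⊥⟩
instance : LE (GenericFun A) := ⟨fun f g => f.1 ≤ g.1⟩
instance : LT (GenericFun A) := ⟨fun f g => f.1 < g.1⟩

instance : HeytingAlgebra (GenericFun A) :=
  Function.Injective.heytingAlgebra (fun f : GenericFun A => f.1) Subtype.val_injective
    Iff.rfl Iff.rfl (fun _ _ => rfl) (fun _ _ => rfl) rfl rfl (fun f => himp_bot f.1)
    (fun _ _ => rfl)

variable (A) in
/-- The inclusion of the generically constant functions into all functions. -/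
def inclusion : HeytingHom (GenericFun A) (A → A) where
  toFun f := f.1
  map_sup' _ _ := rfl
  map_inf' _ _ := rfl
  map_bot' := rfl
  map_himp' _ _ := rfl

end GenericFun

/-! ### From generically constant functions to the hyper-MacNeille completion -/

/-- The pairs `(t, b)` such that `f` has the constant value `b` from `t` onwards. -/
def decidedPairs (f : A → A) : Set (A × A) := {w | Decides f w.1 w.2}

theorem mem_lowerPolar_of_decides {f : A → A} {t b : A} (h : Decides f t b) :
    (t, b) ∈ lowerPolar (hyperRel A) (decidedPairs f) :=
  fun _ hv => h.leAt hv

/-- The Galois closed set of pairs lying below a generically constant function. -/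
def GenericFun.toHyperMacNeille (f : GenericFun A) : HyperMacNeille A :=
  Concept.ofIsExtent (hyperRel A) (lowerPolar (hyperRel A) (decidedPairs f.1)) ⟨_, rfl⟩

namespace GenericFun

theorem mem_toHyperMacNeille {f : GenericFun A} {w : A × A} :
    w ∈ f.toHyperMacNeille.carrier ↔
      ∀ t b, Decides f.1 t b → LeAt (w.1 ⊔ t) w.2 b :=
  ⟨fun h t b hb => h (b := (t, b)) hb, fun h v hv => h v.1 v.2 hv⟩

theorem decides_mem {f : GenericFun A} {t b : A} (h : Decides f.1 t b) :
    (t, b) ∈ f.toHyperMacNeille.carrier :=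
  mem_lowerPolar_of_decides h

theorem leAt_of_mem {f : GenericFun A} {w : A × A} {t b : A}
    (hw : w ∈ f.toHyperMacNeille.carrier) (h : Decides f.1 t b) (hwt : w.1 ≤ t) :
    LeAt t w.2 b :=
  (mem_toHyperMacNeille.1 hw t b h).mono (sup_le hwt le_rfl)

/-- Together with `leAt_of_mem`, this reduces membership to comparing constants at densely many
deciding conditions, which is how the homomorphism laws are checked. -/
theorem mem_of_dense {f : GenericFun A} {w : A × A}
    (h : ∀ s, s ≠ ⊤ → w.1 ≤ s → ∃ t, s ≤ t ∧ t ≠ ⊤ ∧ ∃ b, Decides f.1 t b ∧ LeAt t w.2 b) :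
    w ∈ f.toHyperMacNeille.carrier := by
  refine mem_toHyperMacNeille.2 fun u c hc => hyperRel_of_dense (v := (u, c)) fun s hs hw hu => ?_
  obtain ⟨t, hst, ht, b, hb, hle⟩ := h s hs hw
  exact ⟨t, hst, ht, hle.trans ((hb.leAt hc).mono (sup_le le_rfl (hu.trans hst)))⟩

theorem toHyperMacNeille_inf (f g : GenericFun A) :
    (f ⊓ g).toHyperMacNeille = f.toHyperMacNeille ⊓ g.toHyperMacNeille := by
  apply HyperMacNeille.ext_carrier
  rw [HyperMacNeille.carrier_inf]
  ext w
  refine ⟨fun h => ⟨?_, ?_⟩, fun h => ?_⟩ <;> refine mem_of_dense fun s hs hw => ?_ <;>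
    obtain ⟨t, hst, ht, b, c, hb, hc⟩ := f.2.exists_pair g.2 hs
  · exact ⟨t, hst, ht, b, hb,
      (leAt_of_mem h (hb.inf hc) (hw.trans hst)).trans (.of_le inf_le_left)⟩
  · exact ⟨t, hst, ht, c, hc,
      (leAt_of_mem h (hb.inf hc) (hw.trans hst)).trans (.of_le inf_le_right)⟩
  · exact ⟨t, hst, ht, b ⊓ c, hb.inf hc,
      (leAt_of_mem h.1 hb (hw.trans hst)).le_inf (leAt_of_mem h.2 hc (hw.trans hst))⟩

theorem toHyperMacNeille_mono {f g : GenericFun A} (h : f ≤ g) :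
    f.toHyperMacNeille ≤ g.toHyperMacNeille := by
  rw [← inf_eq_left, ← toHyperMacNeille_inf, inf_eq_left.2 h]

theorem toHyperMacNeille_sup (f g : GenericFun A) :
    (f ⊔ g).toHyperMacNeille = f.toHyperMacNeille ⊔ g.toHyperMacNeille := by
  refine le_antisymm (HyperMacNeille.le_iff.2 fun w hw => HyperMacNeille.mem_iff.2 fun z hz => ?_)
    (sup_le (toHyperMacNeille_mono le_sup_left) (toHyperMacNeille_mono le_sup_right))
  refine hyperRel_of_dense fun s hs hws hzs => ?_
  obtain ⟨t, hst, ht, b, c, hb, hc⟩ := f.2.exists_pair g.2 hs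
  have hzt : t ⊔ z.1 ≤ t := sup_le le_rfl (hzs.trans hst)
  -- The pairs `(t, b)` and `(t, c)` lie in the two joinands, so an upper bound `z` of the join
  -- bounds both constants.
  have hbz : LeAt t b z.2 :=
    LeAt.mono (hz (HyperMacNeille.le_iff.1 le_sup_left (decides_mem hb))) hzt
  have hcz : LeAt t c z.2 :=
    LeAt.mono (hz (HyperMacNeille.le_iff.1 le_sup_right (decides_mem hc))) hzt
  exact ⟨t, hst, ht, (leAt_of_mem hw (hb.sup hc) (hws.trans hst)).trans (hbz.sup_le hcz)⟩

theorem toHyperMacNeille_bot : (⊥ : GenericFun A).toHyperMacNeille = ⊥ := by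
  refine le_bot_iff.1 (HyperMacNeille.le_iff.2 fun w hw => HyperMacNeille.mem_iff.2 fun z _ => ?_)
  have h := mem_toHyperMacNeille.1 hw ⊥ ⊥ (.const ⊥ ⊥)
  exact (h.trans (.of_le bot_le)).mono (sup_le_sup_left bot_le _)

theorem toHyperMacNeille_himp (f g : GenericFun A) :
    (f ⇨ g).toHyperMacNeille = f.toHyperMacNeille ⇨ g.toHyperMacNeille := by
  apply HyperMacNeille.ext_carrier
  ext w
  constructor
  · refine fun hw v hv => mem_of_dense fun s hs hs' => ?_
    obtain ⟨t, hst, ht, b, c, hb, hc⟩ := f.2.exists_pair g.2 hs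
    have hvb := leAt_of_mem hv hb ((le_sup_left.trans hs').trans hst)
    have hwc := leAt_of_mem hw (hb.himp hc) ((le_sup_right.trans hs').trans hst)
    refine ⟨t, hst, ht, c, hc, (LeAt.inf hvb hwc).trans (.of_le ?_)⟩
    exact inf_himp_le
  · refine fun hw => mem_of_dense fun s hs hws => ?_
    obtain ⟨t, hst, ht, b, c, hb, hc⟩ := f.2.exists_pair g.2 hs
    refine ⟨t, hst, ht, b ⇨ c, hb.himp hc, LeAt.le_himp_iff.2 ?_⟩
    rw [inf_comm]
    exact leAt_of_mem (hw _ (decides_mem hb)) hc (sup_le le_rfl (hws.trans hst))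

variable (A) in
/-- The Heyting homomorphism from generically constant functions to the completion. -/
def toHyperMacNeilleHom : HeytingHom (GenericFun A) (HyperMacNeille A) where
  toFun := toHyperMacNeille
  map_sup' := toHyperMacNeille_sup
  map_inf' := toHyperMacNeille_inf
  map_bot' := toHyperMacNeille_bot
  map_himp' := toHyperMacNeille_himp

end GenericFun

end Generic

/-! ### An equation bounding the size of finitely subdirectly irreducible algebras -/

/-- The equation `⋁ i < j ≤ n, (a i ⇨ a j) = ⊤`, which holds in all algebras with at most `n`
elements. -/
def SatisfiesSizeBound (n : ℕ) (A : Type u) [HeytingAlgebra A] : Prop :=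
  ∀ a : ℕ → A,
    ((Finset.range (n + 1)).sup fun j => (Finset.range j).sup fun i => a i ⇨ a j) = ⊤

/-- Pigeonhole: two of the `n + 1` terms coincide, and the implication between them is `⊤`. -/
theorem satisfiesSizeBound_card (A : Type u) [HeytingAlgebra A] [Finite A] :
    SatisfiesSizeBound (Nat.card A) A := by
  intro a
  have := Fintype.ofFinite A
  obtain ⟨i, hi, j, hj, hij, h⟩ := Finset.exists_ne_map_eq_of_card_lt_of_maps_to
    (s := Finset.range (Nat.card A + 1)) (t := Finset.univ) (f := a)
    (by simp [Nat.card_eq_fintype_card]) (fun _ _ => Finset.mem_coe.2 (Finset.mem_univ _))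
  wlog hlt : i < j generalizing i j
  · exact this j hj i hi hij.symm h.symm (lt_of_le_of_ne (not_lt.1 hlt) hij.symm)
  refine top_le_iff.1 (le_trans ?_ (Finset.le_sup hj))
  refine le_trans ?_ (Finset.le_sup (f := fun i => a i ⇨ a j) (Finset.mem_range.2 hlt))
  rw [h, himp_self]

theorem isHeytingVariety_satisfiesSizeBound (n : ℕ) :
    IsHeytingVariety {A : HeytAlg.{u} | SatisfiesSizeBound n A} where
  homomorphicImage A hA B f hf b := by
    choose g hg using hf
    have h := congrArg f (hA fun i => g (b i))
    simpa only [map_finset_sup, Function.comp_def, map_himp, map_top, hg] using h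
  subalgebra A hA B f hf b := by
    apply hf
    simpa only [map_finset_sup, Function.comp_def, map_himp, map_top] using hA fun i => f (b i)
  product ι F hF a := by
    funext k
    have h := hF k fun i => a i k
    erw [Finset.sup_apply]
    simp only [Finset.sup_apply]
    exact h

/-! ### Surjectivity -/

section Surjective

variable {A : Type u} [HeytingAlgebra A]

namespace HyperMacNeille

variable {X : HyperMacNeille A} {r t a b : A}

theorem mem_carrier_mono (h : (t, a) ∈ X.carrier) (htr : t ≤ r) : (r, a) ∈ X.carrier := by
  simpa [comp, sup_eq_right.2 htr] using comp_mem h (r, ⊤)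

/-- `b` is the value of `X` at `t`. -/
def IsValueAt (X : HyperMacNeille A) (t b : A) : Prop :=
  (t, b) ∈ X.carrier ∧ (t, b) ∈ upperPolar (hyperRel A) X.carrier

theorem mem_upperPolar_mono (h : (t, b) ∈ upperPolar (hyperRel A) X.carrier) (htr : t ≤ r) :
    (r, b) ∈ upperPolar (hyperRel A) X.carrier :=
  fun _ hw => LeAt.mono (h hw) (sup_le_sup_left htr _)

theorem IsValueAt.mono (h : X.IsValueAt t b) (htr : t ≤ r) : X.IsValueAt r b :=
  ⟨mem_carrier_mono h.1 htr, mem_upperPolar_mono h.2 htr⟩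

/-- By symmetry, a value at `t` is unique modulo the filter of `t`. -/
theorem IsValueAt.leAt (h : X.IsValueAt t a) (h' : X.IsValueAt t b) : LeAt t a b :=
  LeAt.mono (h'.2 h.1) (sup_le le_rfl le_rfl)

/-- If no proper extension of `s` carries a value of `X`, then the upper polar of `X` contains
chains of any length that are strictly decreasing at some proper extension of `s`. -/
theorem exists_chain {s : A} (hs : s ≠ ⊤) (h : ∀ t b, s ≤ t → t ≠ ⊤ → ¬ X.IsValueAt t b) (n : ℕ) :
    ∃ (a : ℕ → A) (t : A), s ≤ t ∧ t ≠ ⊤ ∧ (t, a n) ∈ upperPolar (hyperRel A) X.carrier ∧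
      (∀ i j, i < j → j ≤ n → a i ⇨ a j ≤ t) ∧ ∀ i ≤ n, a n ≤ a i := by
  induction n with
  | zero =>
    refine ⟨fun _ => ⊤, s, le_rfl, hs, fun w _ => LeAt.of_le le_top, ?_, fun _ _ => le_rfl⟩
    omega
  | succ n ih =>
    obtain ⟨a, t, hst, ht, hmem, hlt, hle⟩ := ih
    -- The last term bounds `X` but is not a value, so by closedness some `(u, c)` in the upper
    -- polar is not related to it. Failure of `N` makes `t ⊔ u ⊔ (a n ⇨ c)` proper, and `a n ⊓ c`
    -- extends the chain there.
    have hnot : (t, a n) ∉ X.carrier := fun hX => h t (a n) hst ht ⟨hX, hmem⟩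
    rw [mem_iff] at hnot
    push Not at hnot
    obtain ⟨⟨u, c⟩, hz, hne⟩ := hnot
    have hupd : ∀ i ≤ n, Function.update a (n + 1) (a n ⊓ c) i = a i := fun i hi =>
      Function.update_of_ne (by omega) _ _
    refine ⟨Function.update a (n + 1) (a n ⊓ c), t ⊔ u ⊔ (a n ⇨ c),
      hst.trans (le_sup_left.trans le_sup_left), hne, ?_, ?_, ?_⟩
    · rw [Function.update_self]
      intro w hw
      exact LeAt.le_inf
        (LeAt.mono (hmem hw) (sup_le_sup_left (le_sup_left.trans le_sup_left) _))
        (LeAt.mono (hz hw) (sup_le_sup_left (le_sup_right.trans le_sup_left) _))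
    · intro i j hij hj
      rw [hupd i (by omega)]
      rcases hj.lt_or_eq with hj | rfl
      · rw [hupd j (by omega)]
        exact (hlt i j hij (by omega)).trans (le_sup_left.trans le_sup_left)
      · rw [Function.update_self]
        -- Since `a n ≤ a i`, the implication `a i ⇨ a n ⊓ c` lies below `a n ⇨ c`, which the new
        -- condition absorbs.
        exact (himp_le_himp (hle i (by omega)) inf_le_right).trans le_sup_right
    · intro i hi
      rw [Function.update_self]
      rcases hi.lt_or_eq with hi | rfl
      · rw [hupd i (by omega)]
        exact inf_le_left.trans (hle i (by omega))
      · rw [Function.update_self]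

theorem exists_isValueAt {n : ℕ} (hA : SatisfiesSizeBound n A) (X : HyperMacNeille A) {s : A}
    (hs : s ≠ ⊤) : ∃ t, s ≤ t ∧ t ≠ ⊤ ∧ ∃ b, X.IsValueAt t b := by
  by_contra! h
  obtain ⟨a, t, -, ht, -, hlt, -⟩ :=
    exists_chain hs (fun t b hst ht => h t hst ht b) n
  -- Every joinand of the size bound lies below `t`, forcing `t = ⊤`.
  refine ht (top_le_iff.1 ((hA a).ge.trans ?_))
  refine Finset.sup_le fun j hj => Finset.sup_le fun i hi => hlt i j ?_ ?_
  · exact Finset.mem_range.1 hi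
  · exact Nat.lt_succ_iff.1 (Finset.mem_range.1 hj)

open Classical in
/-- A function choosing the values of `X`. -/
noncomputable def value (X : HyperMacNeille A) (t : A) : A :=
  -- The default `⊥` is harmless, since values exist densely and persist at extensions.
  if h : ∃ b, X.IsValueAt t b then h.choose else ⊥

theorem IsValueAt.value (h : X.IsValueAt t b) : X.IsValueAt t (X.value t) := by
  have h' : ∃ b, X.IsValueAt t b := ⟨b, h⟩
  rw [HyperMacNeille.value, dif_pos h']
  exact h'.choose_spec

/-- Choices at different extensions may differ, but `b` remains a value at each of them and so
agrees locally with the choice. -/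
theorem IsValueAt.decides (h : X.IsValueAt t b) : Decides X.value t b := fun _ hr =>
  ⟨(h.mono hr).value.leAt (h.mono hr), (h.mono hr).leAt (h.mono hr).value⟩

end HyperMacNeille

theorem GenericFun.toHyperMacNeilleHom_surjective {n : ℕ} (hA : SatisfiesSizeBound n A) :
    Function.Surjective (GenericFun.toHyperMacNeilleHom A) := by
  intro X
  have hgen : GenericallyConstant X.value := fun s hs =>
    let ⟨t, hst, ht, b, hb⟩ := X.exists_isValueAt hA hs
    ⟨t, hst, ht, b, hb.decides⟩
  refine ⟨⟨X.value, hgen⟩, ?_⟩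
  apply HyperMacNeille.ext_carrier
  ext w
  constructor
  · refine fun hw => HyperMacNeille.mem_iff.2 fun z hz => hyperRel_of_dense fun s hs hws hzs => ?_
    obtain ⟨t, hst, ht, b, hb⟩ := X.exists_isValueAt hA hs
    exact ⟨t, hst, ht, (leAt_of_mem hw hb.decides (hws.trans hst)).trans
      (LeAt.mono (hz hb.1) (sup_le le_rfl (hzs.trans hst)))⟩
  · refine fun hw => mem_of_dense fun s hs hws => ?_
    obtain ⟨t, hst, ht, b, hb⟩ := X.exists_isValueAt hA hs
    exact ⟨t, hst, ht, b, hb.decides, LeAt.mono (hb.2 hw) (sup_le (hws.trans hst) le_rfl)⟩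

end Surjective

theorem mainTheorem3 (V : Set HeytAlg.{u}) (E : HeytAlg.{u}) (hE : Finite E)
    (hV : IsVarietyGeneratedBy V E) : ClosedUnderHyperMacNeille V := by
  intro A hA
  -- The algebras satisfying the size bound form a variety containing `E`, so minimality of `V`
  -- gives the bound for `A`.
  have hbound : SatisfiesSizeBound (Nat.card E) A :=
    hV.least _ (isHeytingVariety_satisfiesSizeBound _) (satisfiesSizeBound_card E) hA
  have hprod : HeytAlg.of (A → A) ∈ V := hV.isVariety.product A (fun _ => A) fun _ => hA
  have hgen : HeytAlg.of (GenericFun A) ∈ V :=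
    hV.isVariety.subalgebra _ hprod _ (GenericFun.inclusion A) Subtype.val_injective
  exact hV.isVariety.homomorphicImage _ hgen _ (GenericFun.toHyperMacNeilleHom A)
    (GenericFun.toHyperMacNeilleHom_surjective hbound)
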